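/- Let $\mathbb{N}_{\ge 2}$ denote the set of integers $n \ge 2$. For every nonempty subset $L \subseteq \mathbb{N}_{\ge 2}$ there exists a Puiseux monoid $M$ (that is, a submonoid $M$ of $(\mathbb{Q}_{\ge 0}, +)$) with $1 \in M$ such that $M$ satisfies the ascending chain condition on principal ideals (every ascending chain $b_0 + M \subseteq b_1 + M \subseteq \cdots$ with all $b_n \in M$ stabilizes) and $\mathsf{L}_M(1) = L$. Here an atom of $M$ is a nonzero element of $M$ that is not the sum of two nonzero elements of $M$, and $\mathsf{L}_M(1)$ is the set of all $\ell \in \mathbb{N}_0$ such that $1 = a_1 + \cdots + a_\ell$ for some atoms $a_1, \dots, a_\ell$ of $M$ (not necessarily distinct). -/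

import Mathlib

/-- The principal ideal `b + M` of an additively written commutative monoid `M`. -/
def principalAddIdeal {M : Type*} [AddCommMonoid M] (b : M) : Set M :=
  {x | ∃ c : M, x = b + c}

/-- The ascending chain condition on principal ideals: every ascending chain
`b 0 + M ⊆ b 1 + M ⊆ ⋯` of principal ideals of `M` stabilizes. -/
def SatisfiesACCP (M : Type*) [AddCommMonoid M] : Prop :=
  ∀ b : ℕ → M, (∀ n, principalAddIdeal (b n) ⊆ principalAddIdeal (b (n + 1))) →
    ∃ m, ∀ n, m ≤ n → principalAddIdeal (b n) = principalAddIdeal (b m)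

/-- A submonoid of the nonnegative rationals (a Puiseux monoid) is reduced:
its only invertible element is `0`. -/
instance puiseuxReduced (M : AddSubmonoid ℚ≥0) : Subsingleton (AddUnits M) where
  allEq u v := by
    have h : ∀ w : AddUnits M, ((w : M) : ℚ≥0) = 0 := fun w => by
      have hw : ((w : M) : ℚ≥0) + (((-w : AddUnits M) : M) : ℚ≥0) = 0 := by
        rw [← AddSubmonoid.coe_add, AddUnits.add_neg, AddSubmonoid.coe_zero]
      exact (add_eq_zero.mp hw).1
    exact AddUnits.ext (Subtype.ext ((h u).trans (h v).symm))

/-- The set `Z(b)` of factorizations of an element `b` of a reduced monoid `M`: the finite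
multisets of atoms of `M` (elements of the free commutative monoid on the set of atoms of `M`)
whose sum is `b`. The atoms of `M` are the `a` with `AddIrreducible a`, i.e. the non-units that
are not a sum of two non-units. -/
def factorizationSet {M : Type*} [AddCommMonoid M] [Subsingleton (AddUnits M)] (b : M) :
    Set (Multiset M) :=
  {z | (∀ a ∈ z, AddIrreducible a) ∧ z.sum = b}

/-- The length set `L_M(b)` of an element `b` of a reduced monoid `M`: the set of all lengths
(numbers of atoms, counted with multiplicity) of the factorizations of `b`. -/
def lengthSet {M : Type*} [AddCommMonoid M] [Subsingleton (AddUnits M)] (b : M) : Set ℕ :=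
  {ℓ | ∃ z ∈ factorizationSet b, Multiset.card z = ℓ}

/-! Attach to each `ℓ ∈ L` its own prime `p > 4ℓ` and the two generators `2/p` and `(p - 2(ℓ-1))/p`;
then `ℓ - 1` copies of the first plus one of the second give `1`. If a sum of generators is integral
at `p`, so is its `p`-part, which is then zero or at least `1`
(`dvd_of_padicNorm_weightedSum_le_one`, `one_le_term`). Hence a sum equal to `1` lives over a single
prime, and size and parity of numerators force the intended factorization, of length `ℓ`. The same
dichotomy shows that the generators are atoms. For ACCP, a fixed element bounds the number of primes
in its representations (`card_support_le`), so the differences along a chain eventually involve a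
fixed set of primes. Their denominators are then bounded, and a bounded monotone sequence of
naturals stabilizes. -/

/-! ### Sums of fractions over distinct primes, and ACCP -/

section WeightedSums

variable {ι N : Type*} [AddCommMonoid N]

/-- The sum `∑ k, w k (h k) / p k`, as an additive map on finitely supported functions. -/
noncomputable def weightedSum (p : ι → ℕ) (w : ι → N →+ ℕ) : (ι →₀ N) →+ ℚ≥0 :=
  Finsupp.liftAddHom fun k =>
    (AddMonoidHom.mulLeft ((p k : ℚ≥0)⁻¹)).comp ((Nat.castAddMonoidHom ℚ≥0).comp (w k))

variable {p : ι → ℕ} {w : ι → N →+ ℕ}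

theorem weightedSum_apply (h : ι →₀ N) :
    weightedSum p w h = ∑ k ∈ h.support, (p k : ℚ≥0)⁻¹ * (w k (h k) : ℚ≥0) := rfl

theorem weightedSum_single (k : ι) (x : N) :
    weightedSum p w (Finsupp.single k x) = (p k : ℚ≥0)⁻¹ * (w k x : ℚ≥0) := by
  simp [weightedSum]

theorem padicNorm_inv_mul_le_one {q r : ℕ} (hq : q.Prime) (hr : r.Prime) (hne : q ≠ r) (n : ℕ) :
    padicNorm q ((r : ℚ)⁻¹ * n) ≤ 1 := by
  have := Fact.mk hq
  have := Fact.mk hr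
  rw [inv_mul_eq_div, padicNorm.div, padicNorm.padicNorm_of_prime_of_ne hne, div_one]
  exact padicNorm.of_nat (p := q) n

theorem padicNorm_sum_le_one {q : ℕ} (hq : q.Prime) (hp : ∀ k, (p k).Prime) (n : ι → ℕ)
    (s : Finset ι) (hs : ∀ k ∈ s, q ≠ p k) :
    padicNorm q (∑ k ∈ s, (p k : ℚ)⁻¹ * (n k : ℚ)) ≤ 1 := by
  have := Fact.mk hq
  exact padicNorm.sum_le' (fun k hk => padicNorm_inv_mul_le_one hq (hp k) (hs k hk) _) zero_le_one

theorem padicNorm_weightedSum_le_one (hp : ∀ k, (p k).Prime) (hinj : Function.Injective p)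
    {h : ι →₀ N} {k : ι} (hk : k ∉ h.support) :
    padicNorm (p k) ((weightedSum p w h : ℚ≥0) : ℚ) ≤ 1 := by
  rw [weightedSum_apply]
  push_cast
  exact padicNorm_sum_le_one (hp k) hp _ _ fun j hj he => hk (hinj he ▸ hj)

/-- If a weighted sum is integral at `p k`, then so is its `k`-th term. -/
theorem dvd_of_padicNorm_weightedSum_le_one (hp : ∀ k, (p k).Prime) (hinj : Function.Injective p)
    {h : ι →₀ N} {k : ι} (hn : padicNorm (p k) ((weightedSum p w h : ℚ≥0) : ℚ) ≤ 1) :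
    p k ∣ w k (h k) := by
  classical
  have := Fact.mk (hp k)
  by_cases hk : k ∈ h.support
  swap
  · simp [Finsupp.notMem_support_iff.mp hk]
  have hsum : ((weightedSum p w h : ℚ≥0) : ℚ) = (p k : ℚ)⁻¹ * (w k (h k) : ℚ)
      + ∑ j ∈ h.support.erase k, (p j : ℚ)⁻¹ * (w j (h j) : ℚ) := by
    rw [weightedSum_apply, ← Finset.add_sum_erase _ _ hk]
    push_cast
    rfl
  have hrest := padicNorm_sum_le_one (hp k) hp (fun j => w j (h j)) (h.support.erase k)
    fun j hj he => Finset.ne_of_mem_erase hj (hinj he).symm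
  have hterm : padicNorm (p k) ((p k : ℚ)⁻¹ * (w k (h k) : ℚ)) ≤ 1 := by
    rw [← sub_eq_iff_eq_add] at hsum
    rw [← hsum]
    exact padicNorm.sub.trans (max_le hn hrest)
  have hpos : (1 : ℚ) < p k := by exact_mod_cast (hp k).one_lt
  rw [inv_mul_eq_div, padicNorm.div, padicNorm.padicNorm_p (hp k).one_lt, div_inv_eq_mul] at hterm
  rw [← padicNorm.nat_lt_one_iff]
  by_contra hcon
  rw [not_lt] at hcon
  nlinarith

theorem one_le_term (hp : ∀ k, (p k).Prime) {k : ι} {n : ℕ} (hn : n ≠ 0) (hd : p k ∣ n) :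
    1 ≤ (p k : ℚ≥0)⁻¹ * (n : ℚ≥0) := by
  have h0 : (0 : ℚ≥0) < p k := by exact_mod_cast (hp k).pos
  rw [inv_mul_eq_div, one_le_div h0]
  exact_mod_cast Nat.le_of_dvd (Nat.pos_of_ne_zero hn) hd

theorem monotone_bounded_stabilizes {s : ℕ → ℕ} (hs : Monotone s) {B : ℕ} (hB : ∀ n, s n ≤ B) :
    ∃ m, ∀ n, m ≤ n → s n = s m := by
  refine ⟨Function.argmin fun n => B - s n, fun n hn => le_antisymm ?_ (hs hn)⟩
  have h1 := Function.argmin_le (fun n => B - s n) n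
  have h2 := hB n
  have h3 := hB (Function.argmin fun n => B - s n)
  omega

theorem weightedSum_eq_zero_iff (hp : ∀ k, (p k).Prime) (hw : ∀ k x, w k x = 0 → x = 0)
    {h : ι →₀ N} : weightedSum p w h = 0 ↔ h = 0 := by
  refine ⟨fun h0 => ?_, fun h0 => by simp [h0]⟩
  rw [weightedSum_apply, Finset.sum_eq_zero_iff] at h0
  ext k
  by_contra hk
  have hk' := h0 k (Finsupp.mem_support_iff.mpr hk)
  rcases mul_eq_zero.mp hk' with h1 | h1
  · exact (hp k).ne_zero (by simpa using h1)
  · exact hk (hw k _ (by exact_mod_cast h1))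

/-- All the representations of a given number as a weighted sum have boundedly many terms. -/
theorem card_support_le (hp : ∀ k, (p k).Prime) (hinj : Function.Injective p)
    (hw : ∀ k x, w k x = 0 → x = 0) {h g : ι →₀ N}
    (hg : weightedSum p w h = weightedSum p w g) :
    h.support.card ≤ ⌊weightedSum p w g⌋₊ + g.support.card := by
  classical
  -- Each index of `h` outside `g.support` has an integral term, so it costs at least `1` of the
  -- common value.
  refine (Finset.card_le_card_sdiff_add_card (t := g.support)).trans (Nat.add_le_add_right ?_ _)
  rw [Nat.le_floor_iff zero_le, ← hg, weightedSum_apply]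
  calc ((h.support \ g.support).card : ℚ≥0) = ∑ k ∈ h.support \ g.support, 1 := by simp
    _ ≤ ∑ k ∈ h.support \ g.support, (p k : ℚ≥0)⁻¹ * (w k (h k) : ℚ≥0) := by
      refine Finset.sum_le_sum fun k hk => ?_
      rw [Finset.mem_sdiff] at hk
      refine one_le_term hp (fun h0 => Finsupp.mem_support_iff.mp hk.1 (hw k _ h0)) ?_
      exact dvd_of_padicNorm_weightedSum_le_one hp hinj
        (hg ▸ padicNorm_weightedSum_le_one hp hinj hk.2)
    _ ≤ _ := Finset.sum_le_sum_of_subset Finset.sdiff_subset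

theorem exists_natCast_eq_prod_mul_weightedSum (hp : ∀ k, (p k).Prime) {h : ι →₀ N}
    {U : Finset ι} (hU : h.support = U) :
    ∃ t : ℕ, (t : ℚ≥0) = (∏ k ∈ U, (p k : ℚ≥0)) * weightedSum p w h := by
  classical
  refine ⟨∑ k ∈ U, (∏ j ∈ U.erase k, p j) * w k (h k), ?_⟩
  rw [weightedSum_apply, hU, Finset.mul_sum]
  push_cast
  refine Finset.sum_congr rfl fun k hk => ?_
  have h0 : (p k : ℚ≥0) ≠ 0 := by exact_mod_cast (hp k).ne_zero
  rw [← Finset.mul_prod_erase U _ hk]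
  field_simp

theorem satisfiesACCP_mrange_weightedSum (hp : ∀ k, (p k).Prime) (hinj : Function.Injective p)
    (hw : ∀ k x, w k x = 0 → x = 0) : SatisfiesACCP (AddMonoidHom.mrange (weightedSum p w)) := by
  classical
  intro b hb
  have hd : ∀ n, ∃ c, b n = b (n + 1) + c := fun n => hb n ⟨0, (add_zero _).symm⟩
  choose d hd using hd
  choose f hf using fun n => (d n).2
  choose r hr using fun n => (b n).2
  -- `F n` represents the total drop from `b 0` to `b n`.
  set F : ℕ → ι →₀ N := fun n => ∑ k ∈ Finset.range n, f k with hF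
  have hsucc : ∀ n, F (n + 1) = F n + f n := fun n => Finset.sum_range_succ _ _
  have hsum : ∀ n, weightedSum p w (F n) + (b n : ℚ≥0) = b 0 := by
    intro n
    induction n with
    | zero => simp [hF]
    | succ n ih =>
      rw [hsucc, map_add, hf, ← ih, hd n]
      push_cast
      ring
  -- Nothing cancels: the weights take values in `ℕ` and vanish only at `0`.
  have hsupp : ∀ x y : ι →₀ N, x.support ⊆ (x + y).support := by
    intro x y k hk
    rw [Finsupp.mem_support_iff] at hk ⊢
    intro h0
    refine hk (hw k _ ?_)
    have h1 := congrArg (w k) h0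
    rw [Finsupp.add_apply, map_add, map_zero] at h1
    omega
  have hmono : Monotone fun n => (F n).support :=
    monotone_nat_of_le_succ fun n => hsucc n ▸ hsupp _ _
  obtain ⟨m, hm⟩ := monotone_bounded_stabilizes (s := fun n => (F n).support.card)
    (fun i j hij => Finset.card_le_card (hmono hij))
    (B := ⌊weightedSum p w (r 0)⌋₊ + (r 0).support.card) (fun n =>
      (Finset.card_le_card (hsupp _ (r n))).trans (card_support_le hp hinj hw (by
        rw [map_add, hr, hr, hsum])))
  have hU : ∀ n, (F (m + n)).support = (F m).support := fun n =>
    (Finset.eq_of_subset_of_card_le (hmono (Nat.le_add_right m n))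
      (hm _ (Nat.le_add_right m n)).le).symm
  choose t ht using fun n => exists_natCast_eq_prod_mul_weightedSum (w := w) hp (hU n)
  set P : ℚ≥0 := ∏ k ∈ (F m).support, (p k : ℚ≥0) with hP
  have hP0 : P ≠ 0 := Finset.prod_ne_zero_iff.mpr fun k _ => by exact_mod_cast (hp k).ne_zero
  -- From `m` on, `P` clears the denominators of all drops, which are bounded by `b 0`.
  obtain ⟨m', hm'⟩ := monotone_bounded_stabilizes (s := t)
    (monotone_nat_of_le_succ fun n => by
      have h1 : (t n : ℚ≥0) ≤ t (n + 1) := by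
        rw [ht, ht, ← add_assoc, hsucc, map_add]
        gcongr
        exact le_self_add
      exact_mod_cast h1)
    (B := ⌊P * b 0⌋₊) (fun n => by
      rw [Nat.le_floor_iff zero_le, ht, ← hsum (m + n)]
      gcongr
      exact le_self_add)
  refine ⟨m + m', fun n hn => congrArg principalAddIdeal (Subtype.ext ?_)⟩
  obtain ⟨n, rfl⟩ := Nat.exists_eq_add_of_le hn
  rw [add_assoc]
  have h1 : weightedSum p w (F (m + (m' + n))) = weightedSum p w (F (m + m')) :=
    mul_left_cancel₀ hP0 (by rw [← ht, ← ht, hm' _ (Nat.le_add_right _ _)])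
  have h2 := (hsum (m + (m' + n))).trans (hsum (m + m')).symm
  rw [h1] at h2
  exact add_left_cancel h2

/-- A weighted sum which is at most `1` and has a term integral at its prime consists of that term
only, and equals `1`. -/
theorem eq_single_of_dvd (hp : ∀ k, (p k).Prime) (hw : ∀ k x, w k x = 0 → x = 0)
    {h : ι →₀ N} (hle : weightedSum p w h ≤ 1) {k : ι} (hk : h k ≠ 0) (hd : p k ∣ w k (h k)) :
    h = Finsupp.single k (h k) ∧ w k (h k) = p k ∧ weightedSum p w h = 1 := by
  have hadd : weightedSum p w h
      = (p k : ℚ≥0)⁻¹ * (w k (h k) : ℚ≥0) + weightedSum p w (h.erase k) := by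
    rw [← weightedSum_single, ← map_add, Finsupp.single_add_erase]
  have h1 := one_le_term hp (fun h0 => hk (hw k _ h0)) hd
  have h2 : weightedSum p w (h.erase k) = 0 := by
    rw [← nonpos_iff_eq_zero, ← add_le_iff_nonpos_right (1 : ℚ≥0)]
    exact (add_le_add_left h1 _).trans (hadd ▸ hle)
  rw [h2, add_zero] at hadd
  have h3 : (p k : ℚ≥0)⁻¹ * (w k (h k) : ℚ≥0) = 1 := le_antisymm (hadd ▸ hle) h1
  refine ⟨?_, ?_, hadd.trans h3⟩
  · conv_lhs => rw [← Finsupp.single_add_erase k h,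
      (weightedSum_eq_zero_iff hp hw).mp h2, add_zero]
  · have h0 : (p k : ℚ≥0) ≠ 0 := by exact_mod_cast (hp k).ne_zero
    rw [inv_mul_eq_one₀ h0] at h3
    exact_mod_cast h3.symm

/-- A nonzero term at an index other than `k` would be integral at its prime and push the value up
to `1`. -/
theorem eq_single_of_weightedSum_lt_one (hp : ∀ k, (p k).Prime) (hinj : Function.Injective p)
    (hw : ∀ k x, w k x = 0 → x = 0) {h : ι →₀ N} {k : ι} {x : N}
    (hlt : w k x < p k) (hh : weightedSum p w h = weightedSum p w (Finsupp.single k x)) :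
    h = Finsupp.single k (h k) ∧ w k (h k) = w k x := by
  classical
  have h0 : (0 : ℚ≥0) < p k := by exact_mod_cast (hp k).pos
  have hlt1 : weightedSum p w h < 1 := by
    rw [hh, weightedSum_single, inv_mul_eq_div, div_lt_one h0]
    exact_mod_cast hlt
  have hs : h = Finsupp.single k (h k) := by
    ext j
    by_cases hj : j = k
    · subst hj
      simp
    rw [Finsupp.single_eq_of_ne hj]
    by_contra hne
    refine hlt1.ne (eq_single_of_dvd hp hw hlt1.le hne ?_).2.2
    refine dvd_of_padicNorm_weightedSum_le_one hp hinj ?_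
    rw [hh]
    refine padicNorm_weightedSum_le_one hp hinj ?_
    rw [Finsupp.notMem_support_iff, Finsupp.single_eq_of_ne hj]
  refine ⟨hs, ?_⟩
  rw [hs, weightedSum_single, weightedSum_single, mul_right_inj' (inv_ne_zero h0.ne')] at hh
  simpa using hh

end WeightedSums

/-! ### Counting generators in formal sums -/

/-- The number of atoms in a formal sum of pairs of multiplicities. -/
noncomputable def pairSize {ι : Type*} : (ι →₀ ℕ × ℕ) →+ ℕ :=
  Finsupp.liftAddHom fun _ => AddMonoidHom.fst ℕ ℕ + AddMonoidHom.snd ℕ ℕ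

theorem pairSize_single {ι : Type*} (k : ι) (x : ℕ × ℕ) :
    pairSize (Finsupp.single k x) = x.1 + x.2 := by
  simp [pairSize]

theorem pairSize_eq_zero_iff {ι : Type*} {h : ι →₀ ℕ × ℕ} : pairSize h = 0 ↔ h = 0 := by
  refine ⟨fun h0 => ?_, fun h0 => by simp [h0]⟩
  change ∑ k ∈ h.support, ((h k).1 + (h k).2) = 0 at h0
  rw [Finset.sum_eq_zero_iff] at h0
  by_contra hne
  obtain ⟨k, hk⟩ := Finsupp.support_nonempty_iff.mpr hne
  have h1 := h0 k hk
  exact Finsupp.mem_support_iff.mp hk (Prod.ext (by simp; omega) (by simp; omega))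

theorem exists_eq_single_add {ι : Type*} {h : ι →₀ ℕ × ℕ} (h0 : h ≠ 0) :
    ∃ k g, h = Finsupp.single k (1, 0) + g ∨ h = Finsupp.single k (0, 1) + g := by
  classical
  obtain ⟨k, hk⟩ := Finsupp.support_nonempty_iff.mpr h0
  rw [Finsupp.mem_support_iff] at hk
  by_cases h1 : (h k).1 = 0
  · have h2 : (h k).2 ≠ 0 := fun h2 => hk (Prod.ext h1 h2)
    refine ⟨k, Finsupp.single k ((h k).1, (h k).2 - 1) + h.erase k, Or.inr ?_⟩
    rw [← add_assoc, ← Finsupp.single_add, Prod.mk_add_mk, zero_add,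
      Nat.add_sub_cancel' (Nat.pos_of_ne_zero h2), Prod.mk.eta, Finsupp.single_add_erase]
  · refine ⟨k, Finsupp.single k ((h k).1 - 1, (h k).2) + h.erase k, Or.inl ?_⟩
    rw [← add_assoc, ← Finsupp.single_add, Prod.mk_add_mk, zero_add,
      Nat.add_sub_cancel' (Nat.pos_of_ne_zero h1), Prod.mk.eta, Finsupp.single_add_erase]

/-! ### The two numerators attached to a length -/

/-- Distinct primes with `4 * ℓ + 2 ≤ lengthPrime ℓ`. -/
noncomputable def lengthPrime (ℓ : ℕ) : ℕ := Nat.nth Nat.Prime (4 * ℓ)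

theorem lengthPrime_prime (ℓ : ℕ) : (lengthPrime ℓ).Prime := Nat.prime_nth_prime _

theorem lengthPrime_injective : Function.Injective lengthPrime := fun a b h => by
  have := Nat.nth_injective Nat.infinite_setOfPred_prime h
  omega

theorem four_mul_add_two_le_lengthPrime (ℓ : ℕ) : 4 * ℓ + 2 ≤ lengthPrime ℓ :=
  Nat.add_two_le_nth_prime _

/-- The numerator over `lengthPrime ℓ` of `i` copies of the first and `j` copies of the second
atom, chosen so that `ℓ - 1` copies of the first and one copy of the second have sum `1`. -/
noncomputable def lengthWeight (ℓ : ℕ) : ℕ × ℕ →+ ℕ :=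
  (AddMonoidHom.mulLeft 2).comp (AddMonoidHom.fst ℕ ℕ) +
    (AddMonoidHom.mulLeft (lengthPrime ℓ - 2 * (ℓ - 1))).comp (AddMonoidHom.snd ℕ ℕ)

theorem lengthWeight_apply (ℓ : ℕ) (x : ℕ × ℕ) :
    lengthWeight ℓ x = 2 * x.1 + (lengthPrime ℓ - 2 * (ℓ - 1)) * x.2 := rfl

theorem lengthPrime_odd {ℓ : ℕ} (hℓ : 2 ≤ ℓ) : lengthPrime ℓ % 2 = 1 := by
  have := four_mul_add_two_le_lengthPrime ℓ
  rcases (lengthPrime_prime ℓ).eq_two_or_odd with h | h <;> omega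

theorem lengthWeight_eq_zero {ℓ : ℕ} (x : ℕ × ℕ) (hx : lengthWeight ℓ x = 0) : x = 0 := by
  have := four_mul_add_two_le_lengthPrime ℓ
  rw [lengthWeight_apply, Nat.add_eq_zero_iff, mul_eq_zero, mul_eq_zero] at hx
  exact Prod.ext (by simp; omega) (by simp; omega)

theorem eq_of_lengthWeight_eq_prime {ℓ : ℕ} (hℓ : 2 ≤ ℓ) {x : ℕ × ℕ}
    (hx : lengthWeight ℓ x = lengthPrime ℓ) : x = (ℓ - 1, 1) := by
  have h1 := four_mul_add_two_le_lengthPrime ℓ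
  have h2 := lengthPrime_odd hℓ
  obtain ⟨i, j⟩ := x
  rw [lengthWeight_apply] at hx
  obtain ⟨c, hc⟩ : ∃ c, lengthPrime ℓ = c + 2 * (ℓ - 1) := ⟨_, (Nat.sub_add_cancel (by omega)).symm⟩
  rw [hc, Nat.add_sub_cancel] at hx
  -- As `p > 4(ℓ-1)`, the second numerator `c` exceeds `p/2`, so two copies are too many; `j = 0`
  -- then fails because `p` is odd.
  have hj : j < 2 := by
    by_contra hj
    have : c * 2 ≤ c * j := Nat.mul_le_mul_left _ (not_lt.mp hj)
    simp only at hx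
    omega
  simp only at hx
  interval_cases j
  · omega
  · exact Prod.ext (by simp; omega) rfl

theorem eq_of_lengthWeight_eq_fst {ℓ : ℕ} (hℓ : 2 ≤ ℓ) {x : ℕ × ℕ}
    (hx : lengthWeight ℓ x = lengthWeight ℓ (1, 0)) : x = (1, 0) := by
  have h1 := four_mul_add_two_le_lengthPrime ℓ
  obtain ⟨i, j⟩ := x
  simp only [lengthWeight_apply] at hx
  rcases Nat.eq_zero_or_pos j with rfl | hj
  · exact Prod.ext (by simp at hx ⊢; omega) rfl
  · have := Nat.le_mul_of_pos_right (lengthPrime ℓ - 2 * (ℓ - 1)) hj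
    omega

theorem eq_of_lengthWeight_eq_snd {ℓ : ℕ} (hℓ : 2 ≤ ℓ) {x : ℕ × ℕ}
    (hx : lengthWeight ℓ x = lengthWeight ℓ (0, 1)) : x = (0, 1) := by
  have h1 := four_mul_add_two_le_lengthPrime ℓ
  have h2 := lengthPrime_odd hℓ
  obtain ⟨i, j⟩ := x
  simp only [lengthWeight_apply] at hx
  have hj : j < 2 := by
    by_contra hj
    have := Nat.mul_le_mul_left (lengthPrime ℓ - 2 * (ℓ - 1)) (not_lt.mp hj)
    omega
  interval_cases j
  · omega
  · exact Prod.ext (by simp; omega) rfl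

/-! ### The monoid, its atoms and the lengths of `1` -/

section LengthMonoid

variable {L : Set ℕ}

/-- The value in `ℚ≥0` of a formal sum of the atoms attached to the elements of `L`. -/
noncomputable def lengthSum (L : Set ℕ) : (L →₀ ℕ × ℕ) →+ ℚ≥0 :=
  weightedSum (fun ℓ : L => lengthPrime ℓ) (fun ℓ : L => lengthWeight ℓ)

theorem lengthSum_eq_zero_iff {h : L →₀ ℕ × ℕ} : lengthSum L h = 0 ↔ h = 0 :=
  weightedSum_eq_zero_iff (fun _ => lengthPrime_prime _) fun _ => lengthWeight_eq_zero

theorem lengthSum_single_pred_one {ℓ : L} (hℓ : 2 ≤ (ℓ : ℕ)) :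
    lengthSum L (Finsupp.single ℓ ((ℓ : ℕ) - 1, 1)) = 1 := by
  have h1 := four_mul_add_two_le_lengthPrime ℓ
  have h2 : lengthWeight ℓ ((ℓ : ℕ) - 1, 1) = lengthPrime ℓ := by
    simp only [lengthWeight_apply]
    omega
  have h0 : (lengthPrime ℓ : ℚ≥0) ≠ 0 := by exact_mod_cast (lengthPrime_prime ℓ).ne_zero
  rw [lengthSum, weightedSum_single, h2, inv_mul_cancel₀ h0]

theorem pairSize_mem_of_lengthSum_eq_one (hL : ∀ ℓ ∈ L, 2 ≤ ℓ) {h : L →₀ ℕ × ℕ}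
    (hh : lengthSum L h = 1) : pairSize h ∈ L := by
  have hp : ∀ ℓ : L, (lengthPrime ℓ).Prime := fun _ => lengthPrime_prime _
  have h0 : h ≠ 0 := by
    rintro rfl
    simp at hh
  obtain ⟨k, hk⟩ := Finsupp.support_nonempty_iff.mpr h0
  have hd := dvd_of_padicNorm_weightedSum_le_one (p := fun ℓ : L => lengthPrime ℓ)
    (w := fun ℓ : L => lengthWeight ℓ) (h := h) (k := k) hp
    (lengthPrime_injective.comp Subtype.val_injective) (by
      change padicNorm _ ((lengthSum L h : ℚ≥0) : ℚ) ≤ 1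
      simp [hh])
  obtain ⟨h1, h2, -⟩ := eq_single_of_dvd hp (fun _ => lengthWeight_eq_zero) hh.le
    (Finsupp.mem_support_iff.mp hk) hd
  have hk2 := hL k k.2
  rw [h1, pairSize_single, eq_of_lengthWeight_eq_prime hk2 h2, Nat.sub_add_cancel (by omega)]
  exact k.2

theorem eq_single_of_lengthSum_eq_fst {k : L} (hk : 2 ≤ (k : ℕ)) {h : L →₀ ℕ × ℕ}
    (hh : lengthSum L h = lengthSum L (Finsupp.single k (1, 0))) :
    h = Finsupp.single k (1, 0) := by
  have h1 := four_mul_add_two_le_lengthPrime k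
  obtain ⟨h2, h3⟩ := eq_single_of_weightedSum_lt_one (fun _ => lengthPrime_prime _)
    (lengthPrime_injective.comp Subtype.val_injective) (fun _ => lengthWeight_eq_zero)
    (by simp only [lengthWeight_apply]; omega) hh
  rw [h2, eq_of_lengthWeight_eq_fst hk h3]

theorem eq_single_of_lengthSum_eq_snd {k : L} (hk : 2 ≤ (k : ℕ)) {h : L →₀ ℕ × ℕ}
    (hh : lengthSum L h = lengthSum L (Finsupp.single k (0, 1))) :
    h = Finsupp.single k (0, 1) := by
  have h1 := four_mul_add_two_le_lengthPrime k
  obtain ⟨h2, h3⟩ := eq_single_of_weightedSum_lt_one (fun _ => lengthPrime_prime _)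
    (lengthPrime_injective.comp Subtype.val_injective) (fun _ => lengthWeight_eq_zero)
    (by simp only [lengthWeight_apply]; omega) hh
  rw [h2, eq_of_lengthWeight_eq_snd hk h3]

theorem lengthSum_rangeRestrict_eq_zero_iff {h : L →₀ ℕ × ℕ} :
    (lengthSum L).mrangeRestrict h = 0 ↔ h = 0 := by
  rw [← lengthSum_eq_zero_iff, Subtype.ext_iff]
  rfl

/-- Lifting a decomposition to formal sums splits `g` itself, and one part must have size `0`. -/
theorem addIrreducible_of_unique {g : L →₀ ℕ × ℕ} (hg : pairSize g = 1)
    (hu : ∀ h, lengthSum L h = lengthSum L g → h = g) :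
    AddIrreducible ((lengthSum L).mrangeRestrict g) := by
  refine ⟨?_, ?_⟩
  · rw [isAddUnit_iff_eq_zero, lengthSum_rangeRestrict_eq_zero_iff]
    rintro rfl
    simp at hg
  · rintro ⟨_, x, rfl⟩ ⟨_, y, rfl⟩ hxy
    have h1 := hu (x + y) (by rw [map_add]; exact (congrArg Subtype.val hxy).symm)
    rw [← h1, map_add] at hg
    have h2 : pairSize x = 0 ∨ pairSize y = 0 := by omega
    rw [isAddUnit_iff_eq_zero, isAddUnit_iff_eq_zero]
    exact h2.imp
      (fun h => lengthSum_rangeRestrict_eq_zero_iff.mpr (pairSize_eq_zero_iff.mp h))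
      (fun h => lengthSum_rangeRestrict_eq_zero_iff.mpr (pairSize_eq_zero_iff.mp h))

theorem exists_pairSize_eq_one_of_addIrreducible {a : AddMonoidHom.mrange (lengthSum L)}
    (ha : AddIrreducible a) : ∃ h, (lengthSum L).mrangeRestrict h = a ∧ pairSize h = 1 := by
  obtain ⟨_, h, rfl⟩ := a
  have h0 : h ≠ 0 := by
    rintro rfl
    exact ha.not_isAddUnit (isAddUnit_iff_eq_zero.mpr (Subtype.ext (map_zero _)))
  -- Split one generator off a representation of the atom: the remainder has to be zero.
  have key : ∀ s g, pairSize s = 1 → h = s + g →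
      ∃ h', lengthSum L h' = lengthSum L h ∧ pairSize h' = 1 := by
    rintro s g hs rfl
    refine ⟨s, ?_, hs⟩
    rcases ha.isAddUnit_or_isAddUnit (a := (lengthSum L).mrangeRestrict s)
      (b := (lengthSum L).mrangeRestrict g) (Subtype.ext (map_add _ _ _)) with h1 | h1 <;>
      rw [isAddUnit_iff_eq_zero, lengthSum_rangeRestrict_eq_zero_iff] at h1
    · simp [h1] at hs
    · rw [h1, add_zero]
  obtain ⟨k, g, hg | hg⟩ := exists_eq_single_add h0
  · obtain ⟨h', h1, h2⟩ := key _ g (pairSize_single _ _) hg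
    exact ⟨h', Subtype.ext h1, h2⟩
  · obtain ⟨h', h1, h2⟩ := key _ g (pairSize_single _ _) hg
    exact ⟨h', Subtype.ext h1, h2⟩

/-- Turns the length of a factorization into the size of a formal sum, where the arithmetic applies.
-/
theorem exists_pairSize_eq_card {z : Multiset (AddMonoidHom.mrange (lengthSum L))}
    (hz : ∀ a ∈ z, AddIrreducible a) :
    ∃ h, (lengthSum L).mrangeRestrict h = z.sum ∧ pairSize h = Multiset.card z := by
  induction z using Multiset.induction_on with
  | empty => exact ⟨0, by simp, by simp⟩
  | cons a z ih =>
    obtain ⟨h, h1, h2⟩ := ih fun b hb => hz b (Multiset.mem_cons_of_mem hb)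
    obtain ⟨g, h3, h4⟩ := exists_pairSize_eq_one_of_addIrreducible (hz a (Multiset.mem_cons_self a z))
    exact ⟨g + h, by rw [map_add, h1, h3, Multiset.sum_cons],
      by rw [map_add, h2, h4, Multiset.card_cons, add_comm]⟩

end LengthMonoid

theorem theorem3p5 (L : Set ℕ) (hne : L.Nonempty) (hL : ∀ ℓ ∈ L, 2 ≤ ℓ) :
    ∃ (M : AddSubmonoid ℚ≥0) (h1 : (1 : ℚ≥0) ∈ M),
      SatisfiesACCP M ∧ lengthSet (⟨1, h1⟩ : M) = L := by
  obtain ⟨ℓ₀, hℓ₀⟩ := hne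
  refine ⟨AddMonoidHom.mrange (lengthSum L),
    ⟨_, lengthSum_single_pred_one (ℓ := ⟨ℓ₀, hℓ₀⟩) (hL _ hℓ₀)⟩,
    satisfiesACCP_mrange_weightedSum (fun _ => lengthPrime_prime _)
      (lengthPrime_injective.comp Subtype.val_injective) (fun _ => lengthWeight_eq_zero),
    Set.ext fun ℓ => ⟨?_, fun hℓ => ?_⟩⟩
  · rintro ⟨z, ⟨hz, hsum⟩, rfl⟩
    obtain ⟨h, h1, h2⟩ := exists_pairSize_eq_card hz
    rw [← h2]
    exact pairSize_mem_of_lengthSum_eq_one hL (congrArg Subtype.val (h1.trans hsum))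
  · have h2 := hL ℓ hℓ
    let k : L := ⟨ℓ, hℓ⟩
    let x := (lengthSum L).mrangeRestrict (Finsupp.single k (1, 0))
    let y := (lengthSum L).mrangeRestrict (Finsupp.single k (0, 1))
    refine ⟨y ::ₘ Multiset.replicate (ℓ - 1) x, ⟨fun a ha => ?_, ?_⟩, ?_⟩
    · rcases Multiset.mem_cons.mp ha with rfl | ha
      · exact addIrreducible_of_unique (pairSize_single _ _)
          fun h hh => eq_single_of_lengthSum_eq_snd h2 hh
      · rw [Multiset.eq_of_mem_replicate ha]
        exact addIrreducible_of_unique (pairSize_single _ _)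
          fun h hh => eq_single_of_lengthSum_eq_fst h2 hh
    · rw [Multiset.sum_cons, Multiset.sum_replicate, ← map_nsmul, ← map_add]
      refine Subtype.ext ((congrArg (lengthSum L) ?_).trans
        (lengthSum_single_pred_one (ℓ := k) h2))
      rw [Finsupp.smul_single, ← Finsupp.single_add]
      simp [k]
    · rw [Multiset.card_cons, Multiset.card_replicate]
      omega
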